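/- Let $H\in(0,1)$. There exists a constant $C_H>0$, depending only on $H$, such that the following holds for every fractional Brownian motion $B=\{B(t):t\ge 0\}$ with Hurst parameter $H$, that is, every centered real-valued Gaussian process on a probability space with (almost surely) continuous sample paths and covariance $$\operatorname{Cov}(B(s),B(t))=\tfrac12\left(t^{2H}+s^{2H}-|t-s|^{2H}\right)\qquad (s,t\ge 0).$$ For all integers $n\ge 1$, all $0<t_1<\cdots<t_n$ and all $\alpha_1,\dots,\alpha_n\in\mathbb{R}$, $$\operatorname{Var}\left(\sum_{j=1}^n \alpha_j B(t_j)\right)\ \ge\ \frac{C_H^{\,n-1}}{n}\sum_{j=1}^n(\alpha_j+\alpha_{j+1}+\cdots+\alpha_n)^2\,(t_j-t_{j-1})^{2H},$$ where $t_0=0$. -/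

import Mathlib

open MeasureTheory ProbabilityTheory
open scoped NNReal

/-- `B = {B(t) : t ≥ 0}` is a fractional Brownian motion with Hurst parameter `H` on the
probability space `(Ω, P)`: a centered Gaussian process with (almost surely) continuous sample
paths and covariance `Cov(B(s), B(t)) = (t^{2H} + s^{2H} - |t - s|^{2H}) / 2`.
The parameter `H` is meant to lie in `(0, 1)`. -/
structure IsFractionalBrownianMotion {Ω : Type*} [MeasurableSpace Ω] (H : ℝ)
    (B : ℝ≥0 → Ω → ℝ) (P : Measure Ω) : Prop where
  isGaussianProcess : IsGaussianProcess B P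
  continuous_paths : ∀ᵐ ω ∂P, Continuous fun t : ℝ≥0 => B t ω
  centered : ∀ t : ℝ≥0, ∫ ω, B t ω ∂P = 0
  covariance_eq : ∀ s t : ℝ≥0, covariance (B s) (B t) P =
    1 / 2 * ((t : ℝ) ^ (2 * H) + (s : ℝ) ^ (2 * H) - |(t : ℝ) - (s : ℝ)| ^ (2 * H))

/-! ### Abel summation. -/

section SummationByParts

variable {E : Type*} [AddCommGroup E] [Module ℝ E]

/-! With `p = H - 1/2`, the kernels `(t - ·)₊ ^ p - (-·)₊ ^ p` in `L²(ℝ)` have the covariance of `B`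
up to the factor `mvnConst p`, so the variance becomes a squared norm (`inner_mvnKernel`). Abel
summation turns the combination into one of the increments `v j`, with the tail sums of `α` as
coefficients. The part `w j` of `v j` living on `(t_{j-1}, t_j)` is orthogonal to all earlier
increments, and by scaling `‖w j‖ / ‖v j‖` is a constant `δ`. Peeling off the last increment
repeatedly bounds each term at the cost of a factor `1 + δ⁻¹` per step
(`norm_smul_le_of_orthogonal_witness`); adding the `n` bounds gives the factor `n`. -/

theorem Fin.sum_Ici_smul_sub_eq {n : ℕ} (a : Fin n → ℝ) (f : Fin (n + 1) → E) :
    ∑ j : Fin n, (∑ k ∈ Finset.Ici j, a k) • (f j.succ - f j.castSucc) =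
      ∑ j : Fin n, a j • (f j.succ - f 0) := by
  induction n with
  | zero => simp
  | succ n ih =>
    have hIci : ∀ j : Fin n, ∑ k ∈ Finset.Ici j.succ, a k = ∑ k ∈ Finset.Ici j, a k.succ := by
      intro j
      rw [← Fin.map_succEmb_Ici, Finset.sum_map]
      rfl
    have hIci0 : Finset.Ici (0 : Fin (n + 1)) = Finset.univ := by
      ext x; simp
    have h := ih (fun j => a j.succ) (fun j => f j.succ)
    rw [Fin.sum_univ_succ, Fin.sum_univ_succ (fun j : Fin (n + 1) => a j • (f j.succ - f 0)), hIci0]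
    simp only [hIci, ← Fin.succ_castSucc, h]
    rw [Fin.sum_univ_succ, add_smul, Finset.sum_smul, add_assoc, ← Finset.sum_add_distrib]
    simp only [Fin.castSucc_zero]
    congr 1
    refine Finset.sum_congr rfl fun j _ => ?_
    rw [← smul_add]
    congr 1
    abel

end SummationByParts

/-! ### Linear combinations of vectors with orthogonal innovations. -/

section Triangular

variable {E : Type*} [NormedAddCommGroup E] [InnerProductSpace ℝ E]

/-- If each `v j` has a component of relative size at least `δ` orthogonal to all earlier vectors,
then the coefficients of a linear combination of the `v j` are controlled by its norm. -/
theorem norm_smul_le_of_orthogonal_witness {δ : ℝ} (hδ : 0 < δ) :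
    ∀ {n : ℕ} (v w : Fin n → E), (∀ j, w j ≠ 0) → (∀ i j, i < j → inner ℝ (w j) (v i) = 0) →
      (∀ j, δ * ‖v j‖ * ‖w j‖ ≤ inner ℝ (w j) (v j)) → ∀ (b : Fin n → ℝ) (k : Fin n),
        ‖b k • v k‖ ≤ (1 + δ⁻¹) ^ (n - 1) * ‖∑ j, b j • v j‖ := by
  intro n
  induction n with
  | zero => intro v w _ _ _ b k; exact k.elim0
  | succ n ih =>
    intro v w hw horth hδw b k
    set S := ∑ j, b j • v j with hS
    set l := Fin.last n
    -- Pairing `S` with `w l` annihilates every term but the last.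
    have hlast : δ * ‖b l • v l‖ ≤ ‖S‖ := by
      have h1 : inner ℝ (w l) S = b l * inner ℝ (w l) (v l) := by
        rw [hS, inner_sum, Finset.sum_eq_single l]
        · rw [inner_smul_right]
        · intro i _ hi
          rw [inner_smul_right, horth i l (lt_of_le_of_ne (Fin.le_last i) hi), mul_zero]
        · simp
      have h2 := abs_real_inner_le_norm (w l) S
      rw [h1, abs_mul] at h2
      have h3 : 0 < ‖w l‖ := norm_pos_iff.2 (hw l)
      have h4 : |b l| * (δ * ‖v l‖ * ‖w l‖) ≤ |b l| * |inner ℝ (w l) (v l)| :=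
        mul_le_mul_of_nonneg_left ((hδw l).trans (le_abs_self _)) (abs_nonneg _)
      rw [norm_smul, Real.norm_eq_abs]
      refine le_of_mul_le_mul_left ?_ h3
      linarith
    have hlast' : ‖b l • v l‖ ≤ δ⁻¹ * ‖S‖ := by
      rw [inv_mul_eq_div, le_div_iff₀ hδ, mul_comm]; exact hlast
    have hK : 1 ≤ 1 + δ⁻¹ := by have := inv_pos.2 hδ; linarith
    set T := ∑ j : Fin n, b j.castSucc • v j.castSucc with hT
    have hST : S = T + b l • v l := by rw [hS, Fin.sum_univ_castSucc]
    have hTS : ‖T‖ ≤ (1 + δ⁻¹) * ‖S‖ := by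
      have h : T = S - b l • v l := by rw [hST]; abel
      rw [h]
      calc _ ≤ ‖S‖ + ‖b l • v l‖ := norm_sub_le _ _
        _ ≤ _ := by linarith
    -- A single vector must lose no factor, since the exponent is then `0`.
    rcases n with _ | m
    · have : k = l := Fin.ext (by have := k.isLt; simp [l])
      subst this
      have : T = 0 := by simp [hT]
      rw [hST, this]; simp
    induction k using Fin.lastCases with
    | last =>
      calc ‖b l • v l‖ ≤ (1 + δ⁻¹) ^ 1 * ‖S‖ := by nlinarith [norm_nonneg S]
        _ ≤ _ := by gcongr; simp
    | cast k =>
      have := ih (fun j => v j.castSucc) (fun j => w j.castSucc) (fun j => hw _)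
        (fun i j hij => horth _ _ (by simpa using hij)) (fun j => hδw _) (fun j => b j.castSucc) k
      calc _ ≤ (1 + δ⁻¹) ^ m * ‖T‖ := this
        _ ≤ (1 + δ⁻¹) ^ m * ((1 + δ⁻¹) * ‖S‖) := by gcongr
        _ = _ := by simp only [Nat.add_sub_cancel]; ring

theorem sum_norm_sq_le_of_orthogonal_witness {δ : ℝ} (hδ : 0 < δ) {n : ℕ} (v w : Fin n → E)
    (hw : ∀ j, w j ≠ 0) (horth : ∀ i j, i < j → inner ℝ (w j) (v i) = 0)
    (hδw : ∀ j, δ * ‖v j‖ * ‖w j‖ ≤ inner ℝ (w j) (v j)) (b : Fin n → ℝ) :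
    ∑ j, ‖b j • v j‖ ^ 2 ≤ n * (((1 + δ⁻¹) ^ 2) ^ (n - 1) * ‖∑ j, b j • v j‖ ^ 2) := by
  have h : ∀ j ∈ Finset.univ, ‖b j • v j‖ ^ 2 ≤
      ((1 + δ⁻¹) ^ 2) ^ (n - 1) * ‖∑ j, b j • v j‖ ^ 2 := by
    intro j _
    rw [← pow_mul, mul_comm 2, pow_mul, ← mul_pow]
    exact pow_le_pow_left₀ (norm_nonneg _)
      (norm_smul_le_of_orthogonal_witness hδ v w hw horth hδw b j) 2
  simpa using Finset.sum_le_card_nsmul _ _ _ h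

end Triangular

/-! ### Integrability and scaling of truncated powers. -/

/-- The truncated power `(t - x)₊ ^ p`, vanishing for `x ≥ t`. -/
noncomputable def truncPow (p t x : ℝ) : ℝ := (Set.Iio t).indicator (fun x => (t - x) ^ p) x

theorem truncPow_of_lt {p t x : ℝ} (h : x < t) : truncPow p t x = (t - x) ^ p :=
  Set.indicator_of_mem (Set.mem_Iio.2 h) _

theorem truncPow_of_le {p t x : ℝ} (h : t ≤ x) : truncPow p t x = 0 :=
  Set.indicator_of_notMem (by simpa using h) _

theorem measurable_truncPow (p t : ℝ) : Measurable (truncPow p t) :=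
  Measurable.indicator (by fun_prop) measurableSet_Iio

theorem indicator_truncPow_sq {p s t : ℝ} :
    (fun x => (Set.Ioi s).indicator (truncPow p t) x ^ 2) =
      (Set.Ioo s t).indicator (fun x => (t - x) ^ (2 * p)) := by
  ext x
  by_cases h1 : s < x
  · by_cases h2 : x < t
    · rw [Set.indicator_of_mem (Set.mem_Ioi.2 h1), Set.indicator_of_mem (Set.mem_Ioo.2 ⟨h1, h2⟩),
        truncPow_of_lt h2, mul_comm, Real.rpow_mul (by linarith), Real.rpow_two]
    · rw [Set.indicator_of_mem (Set.mem_Ioi.2 h1), Set.indicator_of_notMem (by simp [h2]),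
        truncPow_of_le (not_lt.1 h2)]
      simp
  · rw [Set.indicator_of_notMem (by simpa using h1), Set.indicator_of_notMem (by simp [h1])]
    simp

theorem memLp_indicator_truncPow {p s t : ℝ} (hp : -1 < 2 * p) (hst : s ≤ t) :
    MemLp ((Set.Ioi s).indicator (truncPow p t)) 2 volume := by
  rw [memLp_two_iff_integrable_sq
    ((measurable_truncPow p t).indicator measurableSet_Ioi).aestronglyMeasurable,
    indicator_truncPow_sq, integrable_indicator_iff measurableSet_Ioo,
    ← intervalIntegrable_iff_integrableOn_Ioo_of_le hst]
  have := (intervalIntegral.intervalIntegrable_rpow' (a := 0) (b := t - s) hp).comp_sub_left t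
  simpa using this.symm

theorem integral_indicator_truncPow_sq {p s t : ℝ} (hp : -1 < 2 * p) (hst : s ≤ t) :
    ∫ x, (Set.Ioi s).indicator (truncPow p t) x ^ 2 = (t - s) ^ (2 * p + 1) / (2 * p + 1) := by
  rw [indicator_truncPow_sq, integral_indicator measurableSet_Ioo,
    ← integral_Ioc_eq_integral_Ioo, ← intervalIntegral.integral_of_le hst,
    intervalIntegral.integral_comp_sub_left (fun y => y ^ (2 * p)) t, integral_rpow (Or.inl hp),
    sub_self, Real.zero_rpow (by linarith), sub_zero]

/-- Factoring out `y ^ p` leaves `(1 + u) ^ p` with `u = y⁻¹`, which lies between `(1 + u)⁻¹ ≥ 1 -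
u` and `1 + u`. -/
theorem abs_one_add_rpow_sub_rpow_le {p y : ℝ} (hp : |p| ≤ 1) (hy : 0 < y) :
    |(1 + y) ^ p - y ^ p| ≤ y ^ (p - 1) := by
  obtain ⟨hp1, hp2⟩ := abs_le.1 hp
  have hu : 0 < y⁻¹ := inv_pos.2 hy
  have h1 : (1 + y) ^ p = y ^ p * (1 + y⁻¹) ^ p := by
    rw [← Real.mul_rpow hy.le (by positivity)]
    congr 1
    field_simp
    ring
  have h2 : (1 + y⁻¹) ^ p ≤ 1 + y⁻¹ := by
    simpa using Real.rpow_le_rpow_of_exponent_le (x := 1 + y⁻¹) (by linarith) hp2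
  have h3 : 1 - y⁻¹ ≤ (1 + y⁻¹) ^ p := by
    have h := Real.rpow_le_rpow_of_exponent_le (x := 1 + y⁻¹) (by linarith) hp1
    rw [Real.rpow_neg_one] at h
    refine le_trans ?_ h
    rw [← one_div (1 + y⁻¹), le_div_iff₀ (by positivity)]
    nlinarith
  rw [h1, Real.rpow_sub_one hy.ne', div_eq_mul_inv,
    show y ^ p * (1 + y⁻¹) ^ p - y ^ p = y ^ p * ((1 + y⁻¹) ^ p - 1) by ring, abs_mul,
    abs_of_pos (Real.rpow_pos_of_pos hy p)]
  gcongr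
  rw [abs_le]
  constructor <;> linarith

theorem memLp_truncPow_one_sub_truncPow_zero {p : ℝ} (hp : -1 < 2 * p) (hp' : 2 * p < 1) :
    MemLp (fun x => truncPow p 1 x - truncPow p 0 x) 2 volume := by
  have hm : Measurable (fun x => truncPow p 1 x - truncPow p 0 x) :=
    (measurable_truncPow p 1).sub (measurable_truncPow p 0)
  -- Near `-∞` the squared difference is at most `(-x) ^ (2 * p - 2)`, integrable because `2 * p <
  -- 1`; the singularities at `0` and `1` only need `-1 < 2 * p`.
  have htail : MemLp ((Set.Iic (-1)).indicator fun x => truncPow p 1 x - truncPow p 0 x) 2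
      volume := by
    have hm' := (hm.indicator (measurableSet_Iic (a := (-1 : ℝ)))).aestronglyMeasurable
      (μ := volume)
    rw [memLp_two_iff_integrable_sq hm']
    have hint : IntegrableOn (fun x : ℝ => (-x) ^ (2 * p - 2)) (Set.Iic (-1)) := by
      have h : IntegrableOn (fun x : ℝ => x ^ (2 * p - 2)) (Set.Ici 1) :=
        (integrableOn_Ici_iff_integrableOn_Ioi).2
          (integrableOn_Ioi_rpow_of_lt (by linarith) one_pos)
      rw [← integrable_indicator_iff measurableSet_Ici] at h
      rw [← integrable_indicator_iff measurableSet_Iic]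
      refine h.comp_neg.congr (.of_forall fun x => ?_)
      simp [Set.indicator, le_neg]
    refine (hint.integrable_indicator measurableSet_Iic).mono' (hm'.pow 2) (.of_forall fun x => ?_)
    by_cases hx : x ≤ -1
    · rw [Set.indicator_of_mem (Set.mem_Iic.2 hx), Set.indicator_of_mem (Set.mem_Iic.2 hx),
        truncPow_of_lt (by linarith), truncPow_of_lt (by linarith), Real.norm_eq_abs, abs_pow,
        zero_sub, sub_eq_add_neg 1 x]
      have h := abs_one_add_rpow_sub_rpow_le (p := p) (y := -x)
        (abs_le.2 ⟨by linarith, by linarith⟩) (by linarith)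
      calc _ ≤ ((-x) ^ (p - 1)) ^ 2 := by gcongr
        _ = _ := by
          rw [← Real.rpow_two, ← Real.rpow_mul (by linarith)]
          congr 1
          ring
    · rw [Set.indicator_of_notMem (by simpa using hx), Set.indicator_of_notMem (by simpa using hx)]
      simp
  have h := (htail.add (memLp_indicator_truncPow (s := -1) (t := 1) hp (by norm_num))).sub
    (memLp_indicator_truncPow (s := -1) (t := 0) hp (by norm_num))
  convert h using 1
  ext x
  by_cases hx : x ≤ -1
  · simp [hx, not_lt.2 hx, Set.indicator]
  · simp [hx, Set.indicator, not_le.1 hx]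

theorem truncPow_scale {p s t x u : ℝ} (h : 0 < t - s) :
    truncPow p (s + (t - s) * u) x = (t - s) ^ p * truncPow p u ((x - s) / (t - s)) := by
  have hiff : (x - s) / (t - s) < u ↔ x < s + (t - s) * u := by
    rw [div_lt_iff₀ h]
    constructor <;> intro <;> linarith
  by_cases hx : x < s + (t - s) * u
  · have hx' := hiff.2 hx
    rw [truncPow_of_lt hx, truncPow_of_lt hx', ← Real.mul_rpow h.le (by linarith)]
    congr 1
    field_simp
    ring
  · rw [truncPow_of_le (not_lt.1 hx), truncPow_of_le (not_lt.1 (hiff.not.2 hx)), mul_zero]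

theorem truncPow_sub_truncPow_eq {p s t x : ℝ} (h : 0 < t - s) :
    truncPow p t x - truncPow p s x = (t - s) ^ p *
      (truncPow p 1 ((x - s) / (t - s)) - truncPow p 0 ((x - s) / (t - s))) := by
  rw [mul_sub, ← truncPow_scale h, ← truncPow_scale h]
  simp

theorem memLp_truncPow_sub_truncPow {p : ℝ} (hp : -1 < 2 * p) (hp' : 2 * p < 1) (s t : ℝ) :
    MemLp (fun x => truncPow p t x - truncPow p s x) 2 volume := by
  wlog hst : s < t generalizing s t
  · rcases eq_or_lt_of_le (not_lt.1 hst) with rfl | h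
    · simp
    · convert (this t s h).neg using 1
      ext x
      simp
  have h : 0 < t - s := by linarith
  have hm : Measurable (fun x => truncPow p t x - truncPow p s x) :=
    (measurable_truncPow p t).sub (measurable_truncPow p s)
  rw [memLp_two_iff_integrable_sq hm.aestronglyMeasurable]
  have hD := (memLp_truncPow_one_sub_truncPow_zero hp hp').integrable_sq
  simp_rw [truncPow_sub_truncPow_eq h, mul_pow]
  exact ((hD.comp_div h.ne').comp_sub_right s).const_mul _

theorem integral_truncPow_sub_truncPow_sq {p s t : ℝ} (hst : s < t) :
    ∫ x, (truncPow p t x - truncPow p s x) ^ 2 =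
      (t - s) ^ (2 * p + 1) * ∫ x, (truncPow p 1 x - truncPow p 0 x) ^ 2 := by
  have h : 0 < t - s := by linarith
  simp_rw [truncPow_sub_truncPow_eq h, mul_pow]
  rw [integral_const_mul,
    integral_sub_right_eq_self (μ := volume)
      (fun x => (truncPow p 1 (x / (t - s)) - truncPow p 0 (x / (t - s))) ^ 2) s,
    Measure.integral_comp_div (fun x => (truncPow p 1 x - truncPow p 0 x) ^ 2), abs_of_pos h,
    smul_eq_mul, ← mul_assoc, Real.rpow_add_one h.ne', mul_comm 2 p, Real.rpow_mul h.le,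
    Real.rpow_two]

/-! ### Mandelbrot–Van Ness kernels in `L²(ℝ)`. -/

section MandelbrotVanNess

variable {p : ℝ} (hp : -1 < 2 * p) (hp' : 2 * p < 1)

/-- The Mandelbrot–Van Ness kernel `(t - ·)₊ ^ p - (-·)₊ ^ p`, as an element of `L²(ℝ)`. -/
noncomputable def mvnKernel (t : ℝ) : Lp ℝ 2 (volume : Measure ℝ) :=
  (memLp_truncPow_sub_truncPow hp hp' 0 t).toLp _

/-- The squared `L²` norm of the Mandelbrot–Van Ness kernel at time `1`. -/
noncomputable def mvnConst (p : ℝ) : ℝ := ∫ x, (truncPow p 1 x - truncPow p 0 x) ^ 2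

theorem norm_toLp_sq_eq_integral {f : ℝ → ℝ} (hf : MemLp f 2 volume) :
    ‖hf.toLp f‖ ^ 2 = ∫ x, f x ^ 2 := by
  rw [← real_inner_self_eq_norm_sq, L2.inner_def]
  refine integral_congr_ae ?_
  filter_upwards [hf.coeFn_toLp] with x hx
  rw [hx, real_inner_self_eq_norm_sq, Real.norm_eq_abs, sq_abs]

theorem inner_toLp_eq_integral {f g : ℝ → ℝ} (hf : MemLp f 2 volume) (hg : MemLp g 2 volume) :
    inner ℝ (hf.toLp f) (hg.toLp g) = ∫ x, f x * g x := by
  rw [L2.inner_def]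
  refine integral_congr_ae ?_
  filter_upwards [hf.coeFn_toLp, hg.coeFn_toLp] with x hx hy
  rw [hx, hy]
  simp [mul_comm]

theorem mvnKernel_zero : mvnKernel hp hp' 0 = 0 := by
  rw [← norm_eq_zero, ← sq_eq_zero_iff, mvnKernel, norm_toLp_sq_eq_integral]
  simp

theorem norm_mvnKernel_sub_sq (s t : ℝ) :
    ‖mvnKernel hp hp' t - mvnKernel hp hp' s‖ ^ 2 = |t - s| ^ (2 * p + 1) * mvnConst p := by
  wlog hst : s < t generalizing s t
  · rcases eq_or_lt_of_le (not_lt.1 hst) with rfl | h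
    · simp [Real.zero_rpow (by linarith : 2 * p + 1 ≠ 0)]
    · rw [norm_sub_rev, this t s h, abs_sub_comm]
  rw [mvnKernel, mvnKernel, ← MemLp.toLp_sub, norm_toLp_sq_eq_integral, abs_of_pos (by linarith),
    mvnConst, ← integral_truncPow_sub_truncPow_sq hst]
  simp

theorem norm_mvnKernel_sq (t : ℝ) :
    ‖mvnKernel hp hp' t‖ ^ 2 = |t| ^ (2 * p + 1) * mvnConst p := by
  simpa [mvnKernel_zero] using norm_mvnKernel_sub_sq hp hp' 0 t

theorem inner_mvnKernel (s t : ℝ) :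
    inner ℝ (mvnKernel hp hp' s) (mvnKernel hp hp' t) =
      mvnConst p * (1 / 2 * (|t| ^ (2 * p + 1) + |s| ^ (2 * p + 1) - |t - s| ^ (2 * p + 1))) := by
  have h := norm_sub_sq_real (mvnKernel hp hp' t) (mvnKernel hp hp' s)
  rw [norm_mvnKernel_sub_sq, norm_mvnKernel_sq, norm_mvnKernel_sq, real_inner_comm] at h
  linarith

/-- The restriction of `(t - ·)₊ ^ p` to `(s, t)`, as an element of `L²(ℝ)`. -/
noncomputable def mvnInnovation {s t : ℝ} (hst : s ≤ t) : Lp ℝ 2 (volume : Measure ℝ) :=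
  (memLp_indicator_truncPow hp hst).toLp _

theorem norm_mvnInnovation_sq {s t : ℝ} (hst : s ≤ t) :
    ‖mvnInnovation hp hst‖ ^ 2 = (t - s) ^ (2 * p + 1) / (2 * p + 1) := by
  rw [mvnInnovation, norm_toLp_sq_eq_integral, integral_indicator_truncPow_sq hp hst]

/-- The supports are disjoint: the kernel at time `u ≤ s` vanishes on `(s, ∞)`. -/
theorem inner_mvnInnovation_of_le {s t u : ℝ} (hs : 0 ≤ s) (hst : s ≤ t) (hu : u ≤ s) :
    inner ℝ (mvnInnovation hp hst) (mvnKernel hp hp' u) = 0 := by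
  rw [mvnInnovation, mvnKernel, inner_toLp_eq_integral]
  refine integral_eq_zero_of_ae (.of_forall fun x => ?_)
  by_cases hx : s < x
  · simp [truncPow_of_le (hu.trans hx.le), truncPow_of_le (hs.trans hx.le)]
  · simp [hx]

/-- As `0 ≤ s`, the kernel at time `t` agrees with the innovation on `(s, ∞)`. -/
theorem inner_mvnInnovation_self {s t : ℝ} (hs : 0 ≤ s) (hst : s ≤ t) :
    inner ℝ (mvnInnovation hp hst) (mvnKernel hp hp' t) = ‖mvnInnovation hp hst‖ ^ 2 := by
  rw [mvnInnovation, mvnKernel, inner_toLp_eq_integral, norm_toLp_sq_eq_integral]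
  refine integral_congr_ae (.of_forall fun x => ?_)
  by_cases hx : s < x
  · simp [truncPow_of_le (hs.trans hx.le), hx, sq]
  · simp [hx]

theorem mvnConst_pos {p : ℝ} (hp : -1 < 2 * p) (hp' : 2 * p < 1) : 0 < mvnConst p := by
  have h1 : 0 < ‖mvnInnovation hp zero_le_one‖ ^ 2 := by
    rw [norm_mvnInnovation_sq, sub_zero, Real.one_rpow]
    exact div_pos one_pos (by linarith)
  have h2 : mvnKernel hp hp' 1 ≠ 0 := by
    intro h
    have := inner_mvnInnovation_self hp hp' le_rfl zero_le_one
    rw [h, inner_zero_right] at this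
    linarith
  have h3 : 0 < ‖mvnKernel hp hp' 1‖ ^ 2 := by have := norm_pos_iff.2 h2; positivity
  rw [norm_mvnKernel_sq] at h3
  simpa using h3

/-- Lower bound for linear combinations of Mandelbrot–Van Ness kernels. -/
theorem le_norm_sum_mvnKernel_sq {n : ℕ} (t : Fin (n + 1) → ℝ) (ht0 : t 0 = 0)
    (ht : StrictMono t) (a : Fin n → ℝ) :
    mvnConst p * ∑ j : Fin n, (∑ k ∈ Finset.Ici j, a k) ^ 2 *
        (t j.succ - t j.castSucc) ^ (2 * p + 1) ≤
      n * (((1 + √((2 * p + 1) * mvnConst p)) ^ 2) ^ (n - 1) *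
        ‖∑ j : Fin n, a j • mvnKernel hp hp' (t j.succ)‖ ^ 2) := by
  have hc := mvnConst_pos hp hp'
  have hq : 0 < 2 * p + 1 := by linarith
  have hstep : ∀ j : Fin n, t j.castSucc < t j.succ := fun j => ht Fin.castSucc_lt_succ
  have hnn : ∀ j, 0 ≤ t j := fun j => ht0 ▸ ht.monotone (Fin.zero_le j)
  set v : Fin n → Lp ℝ 2 (volume : Measure ℝ) :=
    fun j => mvnKernel hp hp' (t j.succ) - mvnKernel hp hp' (t j.castSucc) with hv
  set w : Fin n → Lp ℝ 2 (volume : Measure ℝ) := fun j => mvnInnovation hp (hstep j).le with hw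
  -- The ratio `‖w j‖ / ‖v j‖`: both squared norms are multiples of the step length to the power `2
  -- * p + 1`.
  set δ := (√((2 * p + 1) * mvnConst p))⁻¹ with hδ
  have hδ0 : 0 < δ := by positivity
  have hvn : ∀ j, ‖v j‖ ^ 2 = (t j.succ - t j.castSucc) ^ (2 * p + 1) * mvnConst p := fun j => by
    rw [hv, norm_mvnKernel_sub_sq, abs_of_pos (sub_pos.2 (hstep j))]
  have hwn : ∀ j, ‖w j‖ = δ * ‖v j‖ := fun j => by
    rw [← sq_eq_sq₀ (norm_nonneg _) (by positivity), hw, norm_mvnInnovation_sq, mul_pow, hvn, hδ,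
      inv_pow, Real.sq_sqrt (by positivity)]
    field_simp
  have hwv : ∀ j, inner ℝ (w j) (v j) = ‖w j‖ ^ 2 := fun j => by
    rw [hv, hw, inner_sub_right, inner_mvnInnovation_self hp hp' (hnn _),
      inner_mvnInnovation_of_le hp hp' (hnn _) _ le_rfl, sub_zero]
  have key := sum_norm_sq_le_of_orthogonal_witness hδ0 v w
    (fun j => by
      have h : 0 < ‖w j‖ ^ 2 := by
        rw [hw, norm_mvnInnovation_sq]
        exact div_pos (Real.rpow_pos_of_pos (sub_pos.2 (hstep j)) _) hq
      intro h0
      simp [h0] at h)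
    (fun i j hij => by
      rw [hv, hw, inner_sub_right, inner_mvnInnovation_of_le hp hp' (hnn _),
        inner_mvnInnovation_of_le hp hp' (hnn _), sub_zero]
      · exact ht.monotone (Fin.castSucc_le_castSucc_iff.2 hij.le)
      · exact ht.monotone (Fin.succ_le_castSucc_iff.2 hij))
    (fun j => by rw [hwv, sq, hwn])
    (fun j => ∑ k ∈ Finset.Ici j, a k)
  rw [hv, Fin.sum_Ici_smul_sub_eq a fun j => mvnKernel hp hp' (t j)] at key
  simp only [ht0, mvnKernel_zero, sub_zero] at key
  rw [hδ, inv_inv] at key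
  refine le_trans (le_of_eq ?_) key
  rw [Finset.mul_sum]
  refine Finset.sum_congr rfl fun j _ => ?_
  rw [norm_smul, mul_pow, Real.norm_eq_abs, sq_abs]
  have := hvn j
  rw [hv] at this
  rw [this]
  ring

end MandelbrotVanNess

/-! ### Transfer to fractional Brownian motion. -/

theorem IsFractionalBrownianMotion.norm_sum_mvnKernel_sq {Ω : Type*} [MeasurableSpace Ω]
    {P : Measure Ω} [IsProbabilityMeasure P] {H : ℝ} {B : ℝ≥0 → Ω → ℝ}
    (hB : IsFractionalBrownianMotion H B P) {p : ℝ} (hp : -1 < 2 * p) (hp' : 2 * p < 1)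
    (hpH : 2 * p + 1 = 2 * H) {n : ℕ} (t : Fin n → ℝ≥0) (a : Fin n → ℝ) :
    ‖∑ j, a j • mvnKernel hp hp' (t j)‖ ^ 2 =
      mvnConst p * variance (fun ω => ∑ j, a j * B (t j) ω) P := by
  have hL : ∀ j, MemLp (fun ω => a j * B (t j) ω) 2 P := fun j =>
    (hB.isGaussianProcess.hasGaussianLaw_eval (t j)).memLp_two.const_mul (a j)
  rw [variance_fun_sum hL, ← real_inner_self_eq_norm_sq, sum_inner, Finset.mul_sum]
  refine Finset.sum_congr rfl fun i _ => ?_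
  rw [inner_sum, Finset.mul_sum]
  refine Finset.sum_congr rfl fun j _ => ?_
  rw [real_inner_smul_left, real_inner_smul_right, inner_mvnKernel, covariance_const_mul_left,
    covariance_const_mul_right, hB.covariance_eq, hpH, NNReal.abs_eq, NNReal.abs_eq]
  ring

theorem proposition7p5 (H : ℝ) (hH : H ∈ Set.Ioo (0 : ℝ) 1) :
    ∃ C : ℝ, 0 < C ∧
      ∀ (Ω : Type*) [MeasurableSpace Ω] (P : Measure Ω) [IsProbabilityMeasure P]
        (B : ℝ≥0 → Ω → ℝ), IsFractionalBrownianMotion H B P →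
      ∀ n : ℕ, 1 ≤ n →
      ∀ t : Fin (n + 1) → ℝ≥0, t 0 = 0 → StrictMono t →
      ∀ α : Fin n → ℝ,
        C ^ (n - 1) / (n : ℝ) *
            ∑ j : Fin n, (∑ k ∈ Finset.Ici j, α k) ^ 2 *
              ((t j.succ : ℝ) - (t j.castSucc : ℝ)) ^ (2 * H)
          ≤ variance (fun ω => ∑ j : Fin n, α j * B (t j.succ) ω) P := by
  obtain ⟨hH0, hH1⟩ := hH
  have hp : -1 < 2 * (H - 1 / 2) := by linarith
  have hp' : 2 * (H - 1 / 2) < 1 := by linarith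
  have hpH : 2 * (H - 1 / 2) + 1 = 2 * H := by ring
  have hc := mvnConst_pos hp hp'
  set K : ℝ := (1 + √((2 * (H - 1 / 2) + 1) * mvnConst (H - 1 / 2))) ^ 2 with hK
  have hK0 : 0 < K := by positivity
  refine ⟨K⁻¹, inv_pos.2 hK0, fun Ω _ P _ B hB n hn t ht0 ht α => ?_⟩
  have h := le_norm_sum_mvnKernel_sq hp hp' (fun j => (t j : ℝ)) (by simp [ht0])
    (fun i j hij => NNReal.coe_lt_coe.2 (ht hij)) α
  rw [hB.norm_sum_mvnKernel_sq hp hp' hpH, ← hK, hpH] at h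
  have hn0 : (0 : ℝ) < n := by exact_mod_cast hn
  rw [inv_pow, div_mul_eq_mul_div, div_le_iff₀ hn0, inv_mul_le_iff₀ (by positivity)]
  -- The factor `mvnConst (H - 1 / 2)` occurs on both sides and cancels.
  refine le_of_mul_le_mul_left (h.trans (le_of_eq ?_)) hc
  ring
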